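/- A \emph{variety of groups} is a class $\mathcal V$ of groups closed under Cartesian products, subgroups and quotients (homomorphic images). A subset $X$ of a group $G$ is \emph{$\mathcal V$-independent} if the subgroup $\langle X\rangle$ generated by $X$ belongs to $\mathcal V$ and, for every $H\in\mathcal V$, every map $f:X\to H$ extends to a homomorphism $\langle X\rangle\to H$. The \emph{$\mathcal V$-rank} of $G\in\mathcal V$ is $r_{\mathcal V}(G)=\sup\{|X| : X\subseteq G \text{ is } \mathcal V\text{-independent}\}$, and a group is \emph{$\mathcal V$-free} if it is generated by a $\mathcal V$-independent subset. A subgroup $D$ of a topological group $G$ is \emph{$G_\delta$-dense} if it meets every non-empty $G_\delta$-subset of $G$. A space is \emph{pseudocompact} if every continuous real-valued function on it is bounded. The \emph{weight} $w(X)$ of a space $X$ is the least cardinality of a base of $X$, and $X$ is \emph{$w$-compact} if it has a compact subset $C$ with $w(C)=w(X)$. \textbf{Theorem.} Let $\mathcal V$ be a variety of groups and let $L\in\mathcal V$ be a compact metrizable topological group such that $r_{\mathcal V}(L^{\omega})\ge\omega$. Let $I$ be a set with $\omega_1\le |I|\le\mathfrak c$. Then the topological group $L^I$ (with the product topology) contains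 a $G_\delta$-dense, hence dense and pseudocompact, $\mathcal V$-free subgroup $D$ of cardinality $\mathfrak c$ such that all compact subsets of $D$ are countable; in particular, $D$ is not $w$-compact. -/

import Mathlib

open Cardinal

universe u

/-- A variety of groups: a class of groups closed under Cartesian products, subgroups and
quotients. Quotients are taken in the form of homomorphic images, so that the class is also
closed under isomorphism. -/
structure GroupVariety where
  /-- Membership of a group in the class. -/
  Mem : (G : Type u) → [Group G] → Prop
  pi_mem : ∀ (ι : Type u) (G : ι → Type u) [∀ i, Group (G i)],
    (∀ i, Mem (G i)) → Mem (∀ i, G i)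
  subgroup_mem : ∀ (G : Type u) [Group G] (H : Subgroup G), Mem G → Mem H
  quotient_mem : ∀ (G H : Type u) [Group G] [Group H] (f : G →* H),
    Function.Surjective f → Mem G → Mem H

namespace GroupVariety

/-- `X ⊆ G` is `V`-independent: `⟨X⟩` belongs to `V`, and every map from `X` to a group of `V`
extends to a homomorphism on `⟨X⟩`. -/
def Independent (V : GroupVariety.{u}) {G : Type u} [Group G] (X : Set G) : Prop :=
  V.Mem (Subgroup.closure X) ∧
    ∀ (H : Type u) [Group H], V.Mem H → ∀ f : X → H,
      ∃ φ : Subgroup.closure X →* H, ∀ x : X, φ ⟨x, Subgroup.subset_closure x.2⟩ = f x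

/-- The `V`-rank of `G`: the supremum of the cardinalities of its `V`-independent subsets. -/
noncomputable def rank (V : GroupVariety.{u}) (G : Type u) [Group G] : Cardinal.{u} :=
  ⨆ X : {X : Set G // V.Independent X}, #(X : Set G)

/-- `G` is `V`-free: it is generated by a `V`-independent subset. -/
def IsFree (V : GroupVariety.{u}) (G : Type u) [Group G] : Prop :=
  ∃ X : Set G, V.Independent X ∧ Subgroup.closure X = ⊤

end GroupVariety

/-- `D` meets every non-empty `G_δ`-subset of `X`. -/
def GDeltaDense {X : Type u} [TopologicalSpace X] (D : Set X) : Prop :=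
  ∀ B : Set X, IsGδ B → B.Nonempty → (D ∩ B).Nonempty

/-- Every continuous real-valued function on `X` is bounded. -/
def IsPseudocompact (X : Type u) [TopologicalSpace X] : Prop :=
  ∀ f : X → ℝ, Continuous f → ∃ M : ℝ, ∀ x, |f x| ≤ M

/-- The weight of `X`: the least cardinality of a base of its topology. -/
noncomputable def topWeight (X : Type u) [TopologicalSpace X] : Cardinal.{u} :=
  sInf {κ | ∃ B : Set (Set X), TopologicalSpace.IsTopologicalBasis B ∧ #B = κ}

/-- `X` is `w`-compact: it has a compact subset of the same weight as `X`. -/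
def IsWCompact (X : Type u) [TopologicalSpace X] : Prop :=
  ∃ C : Set X, IsCompact C ∧ topWeight C = topWeight X

/-!
A word that dies on a `V`-independent family is a law of `V`. Hence every set `K` of elements
generated by such a family in `G` has a least support, and if `G` is Polish and `K` is closed and
uncountable, then `|K| = 𝔠` forces the support to have size `𝔠`. As `G` has at most `𝔠` closed
subsets, from an independent family of size `𝔠` in `G = (L ^ ω) ^ ω` one can remove an element of
each of these supports and still keep a family `y` of size `𝔠`: no uncountable closed set lies in
`⟨y⟩`.

Cut `I` into `|I|` blocks of size `ω × ω`. For each of the `𝔠` many countable partial functions `t`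
from blocks to `G`, let `x t` be the point of `L ^ I` that agrees with `t` on its domain and is
equal to `y t` on every other block. The `x t` project onto every countable subproduct, while each
word in `x` agrees on all but countably many blocks with the same word in `y`. So `x` is
independent. If `C ⊆ ⟨x⟩` is compact, any sequence in `C` is controlled by a single block, so that
replacing `x` by `y` in words maps `C` injectively onto a closed subset of `⟨y⟩`, which is
countable.
-/

/-! ### Words and independent families -/

section Words

variable {S T G H : Type*} [Group G] [Group H]

theorem freeGroup_lift_map (g : T → G) (j : S → T) (w : FreeGroup S) :
    FreeGroup.lift g (FreeGroup.map j w) = FreeGroup.lift (g ∘ j) w :=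
  DFunLike.congr_fun (f := (FreeGroup.lift g).comp (FreeGroup.map j)) (by ext; simp) w

theorem map_freeGroup_lift (φ : G →* H) (g : T → G) (w : FreeGroup T) :
    φ (FreeGroup.lift g w) = FreeGroup.lift (φ ∘ g) w :=
  DFunLike.congr_fun (f := φ.comp (FreeGroup.lift g)) (by ext; simp) w

theorem mem_subgroup_closure_range_iff {y : T → G} {k : G} :
    k ∈ Subgroup.closure (Set.range y) ↔ ∃ w, FreeGroup.lift y w = k := by
  rw [← FreeGroup.range_lift_eq_closure, MonoidHom.mem_range]

theorem exists_finset_freeGroup_map_eq (w : FreeGroup T) :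
    ∃ (F : Finset T) (w' : FreeGroup F), FreeGroup.map Subtype.val w' = w := by
  classical
  refine ⟨(w.toWord.map Prod.fst).toFinset, .mk (w.toWord.attach.map fun a ↦
    (⟨a.1.1, List.mem_toFinset.2 (List.mem_map_of_mem a.2)⟩, a.1.2)), ?_⟩
  rw [FreeGroup.map.mk, List.map_map]
  exact (congrArg FreeGroup.mk (List.attach_map_subtype_val _)).trans FreeGroup.mk_toWord

theorem exists_finset_mem_subgroup_closure_image {y : T → G} {k : G}
    (hk : k ∈ Subgroup.closure (Set.range y)) :
    ∃ F : Finset T, k ∈ Subgroup.closure (y '' F) := by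
  obtain ⟨w, rfl⟩ := mem_subgroup_closure_range_iff.1 hk
  obtain ⟨F, w', rfl⟩ := exists_finset_freeGroup_map_eq w
  refine ⟨F, ?_⟩
  rw [Set.image_eq_range, freeGroup_lift_map]
  exact mem_subgroup_closure_range_iff.2 ⟨w', rfl⟩

theorem mk_subgroup_closure_le {G : Type u} [Group G] (X : Set G) :
    #(Subgroup.closure X) ≤ max #X ℵ₀ := by
  rw [FreeGroup.closure_eq_range]
  refine (mk_range_le (f := FreeGroup.lift ((↑) : X → G))).trans ?_
  rcases isEmpty_or_nonempty X with h | h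
  · exact (le_one_iff_subsingleton.2 inferInstance).trans (one_le_aleph0.trans (le_max_right _ _))
  · exact (mk_freeGroup _).le

end Words

namespace GroupVariety

section Independence

variable {V : GroupVariety.{u}} {S T : Type*}

/-- The word `w` is a law of `V`: it is trivial under every substitution of elements of a group
of `V`. -/
def IsLaw (V : GroupVariety.{u}) (w : FreeGroup T) : Prop :=
  ∀ (H : Type u) [Group H], V.Mem H → ∀ g : T → H, FreeGroup.lift g w = 1

theorem IsLaw.map {w : FreeGroup S} (hw : V.IsLaw w) (j : S → T) :
    V.IsLaw (FreeGroup.map j w) := fun H _ hH g ↦ by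
  rw [freeGroup_lift_map, hw H hH]

theorem IsLaw.of_map {w : FreeGroup S} {j : S → T} (hj : Function.Injective j)
    (hw : V.IsLaw (FreeGroup.map j w)) : V.IsLaw w := fun H _ hH g ↦ by
  simpa only [freeGroup_lift_map, Function.extend_comp hj] using hw H hH (Function.extend j g 1)

/-- The only relations satisfied by the family `y` are the laws of `V`. This is `V`-independence of
families, without the condition that the generated subgroup belong to `V`. -/
def IndepFamily (V : GroupVariety.{u}) {G : Type*} [Group G] (y : T → G) : Prop :=
  ∀ w : FreeGroup T, FreeGroup.lift y w = 1 → V.IsLaw w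

theorem Independent.indepFamily {G : Type u} [Group G] {X : Set G} (h : V.Independent X) :
    V.IndepFamily (Subtype.val : X → G) := fun w hw H _ hH g ↦ by
  obtain ⟨φ, hφ⟩ := h.2 H hH g
  let ι : X → Subgroup.closure X := fun x ↦ ⟨x, Subgroup.subset_closure x.2⟩
  have hι : FreeGroup.lift ι w = 1 := by
    apply (Subgroup.closure X).subtype_injective
    rwa [map_freeGroup_lift, map_one]
  rw [← funext hφ, ← Function.comp_def φ ι, ← map_freeGroup_lift, hι, map_one]

theorem mem_pi {ι : Type} {G : Type u} [Group G] (hG : V.Mem G) : V.Mem (ι → G) :=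
  V.quotient_mem (ULift.{u} ι → G) (ι → G)
    { toFun := fun f i ↦ f ⟨i⟩, map_one' := rfl, map_mul' := fun _ _ ↦ rfl }
    (fun f ↦ ⟨fun i ↦ f i.down, rfl⟩) (V.pi_mem _ _ fun _ ↦ hG)

namespace IndepFamily

section

variable {G H : Type*} [Group G] [Group H] {y : T → G}

theorem of_hom_comp (φ : G →* H) (h : V.IndepFamily (φ ∘ y)) : V.IndepFamily y := fun w hw ↦
  h w (by rw [← map_freeGroup_lift, hw, map_one])

theorem comp_injective (h : V.IndepFamily y) {j : S → T} (hj : Function.Injective j) :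
    V.IndepFamily (y ∘ j) := fun w hw ↦
  IsLaw.of_map hj (h _ (by rw [freeGroup_lift_map, hw]))

theorem of_finset (h : ∀ F : Finset T, V.IndepFamily fun t : F ↦ y t) : V.IndepFamily y := by
  intro w hw
  obtain ⟨F, w', rfl⟩ := exists_finset_freeGroup_map_eq w
  rw [freeGroup_lift_map] at hw
  exact (h F w' hw).map _

theorem lift_eq_lift (h : V.IndepFamily y) {w w' : FreeGroup T}
    (hw : FreeGroup.lift y w = FreeGroup.lift y w') {H : Type u} [Group H] (hH : V.Mem H)
    (g : T → H) : FreeGroup.lift g w = FreeGroup.lift g w' := by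
  have := h (w * w'⁻¹) (by rw [map_mul, map_inv, hw, mul_inv_cancel]) H hH g
  rwa [map_mul, map_inv, mul_inv_eq_one] at this

end

variable {G : Type u} [Group G] {y : T → G}

protected theorem injective [Nontrivial G] (h : V.IndepFamily y) (hG : V.Mem G) :
    Function.Injective y := by
  classical
  intro s t hst
  obtain ⟨a, ha⟩ := exists_ne (1 : G)
  by_contra hne
  have := h.lift_eq_lift (w := .of s) (w' := .of t) (by simpa) hG (Function.update 1 s a)
  simp [Ne.symm hne, ha] at this

theorem independent_range (h : V.IndepFamily y) (hG : V.Mem G) : V.Independent (Set.range y) := by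
  refine ⟨V.subgroup_mem G _ hG, fun H _ hH f ↦ ?_⟩
  choose w hw using fun k : Subgroup.closure (Set.range y) ↦ mem_subgroup_closure_range_iff.1 k.2
  let g : T → H := fun t ↦ f ⟨y t, t, rfl⟩
  refine ⟨.mk' (fun k ↦ FreeGroup.lift g (w k)) fun a b ↦ ?_, ?_⟩
  · rw [← map_mul]
    exact h.lift_eq_lift (by simp [hw]) hH g
  · rintro ⟨_, t, rfl⟩
    simpa [g] using h.lift_eq_lift (w' := .of t) ((hw _).trans (by simp)) hH g

theorem isFree_closure_range (h : V.IndepFamily y) (hG : V.Mem G) :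
    V.IsFree (Subgroup.closure (Set.range y)) := by
  let x : T → Subgroup.closure (Set.range y) := fun t ↦ ⟨y t, Subgroup.subset_closure ⟨t, rfl⟩⟩
  have hx : V.IndepFamily x := .of_hom_comp (Subgroup.subtype _) h
  refine ⟨Set.range x, hx.independent_range (V.subgroup_mem _ _ hG), ?_⟩
  rw [← Subgroup.closure_closure_coe_preimage (k := Set.range y)]
  congr 1
  ext d
  simp [x, Subtype.ext_iff]

theorem closure_image_inter (h : V.IndepFamily y) (hG : V.Mem G) (A B : Set T) :
    Subgroup.closure (y '' (A ∩ B)) = Subgroup.closure (y '' A) ⊓ Subgroup.closure (y '' B) := by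
  classical
  refine le_antisymm (le_inf (Subgroup.closure_mono (Set.image_mono Set.inter_subset_left))
    (Subgroup.closure_mono (Set.image_mono Set.inter_subset_right))) ?_
  intro k hk
  obtain ⟨hA, hB⟩ := Subgroup.mem_inf.1 hk
  rw [Set.image_eq_range, mem_subgroup_closure_range_iff] at hA hB
  obtain ⟨a, rfl⟩ := hA
  obtain ⟨b, hb⟩ := hB
  -- Killing the generators outside `B` fixes the element and maps `⟨y '' A⟩` into `⟨y '' (A ∩ B)⟩`.
  let g : T → G := fun t ↦ if t ∈ B then y t else 1
  have hgB : g ∘ (↑) = fun t : B ↦ y t := funext fun t ↦ if_pos t.2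
  have hab : FreeGroup.lift (fun t : A ↦ g t) a = FreeGroup.lift (fun t : A ↦ y t) a := by
    rw [← hb, ← hgB, ← freeGroup_lift_map, ← Function.comp_def g, ← freeGroup_lift_map]
    refine h.lift_eq_lift ?_ hG g
    rw [freeGroup_lift_map, freeGroup_lift_map]
    exact hb.symm
  rw [← hab]
  refine FreeGroup.range_lift_le ?_ ⟨a, rfl⟩
  rintro _ ⟨t, rfl⟩
  by_cases ht : (t : T) ∈ B
  · simp only [g, if_pos ht, SetLike.mem_coe]
    exact Subgroup.subset_closure ⟨t, ⟨t.2, ht⟩, rfl⟩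
  · simp only [g, if_neg ht, SetLike.mem_coe, one_mem]

end IndepFamily

/-- The indices whose generators are needed to generate `K`: if `y` is an independent family
generating `K`, this is the least set of indices whose generators generate `K`. -/
def generatorSupport {G : Type*} [Group G] (y : T → G) (K : Set G) : Set T :=
  {s | ¬ K ⊆ Subgroup.closure (y '' {s}ᶜ)}

theorem IndepFamily.subset_closure_image_generatorSupport {G : Type u} [Group G] {y : T → G}
    (h : V.IndepFamily y) (hG : V.Mem G) {K : Set G} (hK : K ⊆ Subgroup.closure (Set.range y)) :
    K ⊆ Subgroup.closure (y '' generatorSupport y K) := by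
  classical
  intro k hk
  obtain ⟨F, hF⟩ := exists_minimal_of_wellFoundedLT
    (fun F : Finset T ↦ k ∈ Subgroup.closure (y '' F))
    (exists_finset_mem_subgroup_closure_image (hK hk))
  refine Subgroup.closure_mono (Set.image_mono fun s hs hKs ↦ ?_) hF.prop
  refine hF.not_prop_of_lt (Finset.erase_ssubset hs) ?_
  rw [Finset.coe_erase, Set.sdiff_eq, h.closure_image_inter hG]
  exact ⟨hF.prop, hKs hk⟩

end Independence

end GroupVariety

/-! ### Independent families of size continuum -/

section Cardinality

theorem exists_injective_forall_mem {ι S : Type u} (A : ι → Set S) (hA : ∀ i, #ι ≤ #(A i)) :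
    ∃ g : ι → S, Function.Injective g ∧ ∀ i, g i ∈ A i := by
  obtain ⟨_, _, hord⟩ := exists_ord_eq_type_lt ι
  have exists_new (i : ι) (f : ∀ j < i, S) : ∃ s ∈ A i, ∀ j hj, f j hj ≠ s := by
    by_contra! hcon
    have hsub : A i ⊆ Set.range fun j : Set.Iio i ↦ f j j.2 := fun s hs ↦
      let ⟨j, hj, hjs⟩ := hcon s hs
      ⟨⟨j, hj⟩, hjs⟩
    exact (((hA i).trans (mk_le_mk_of_subset hsub)).trans mk_range_le).not_gt (mk_Iio_lt i hord)
  choose c hc hne using exists_new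
  let g : ι → S := WellFoundedLT.fix c
  have hg (i : ι) : g i = c i fun j _ ↦ g j := WellFoundedLT.fix_eq c i
  refine ⟨g, .of_lt_imp_ne fun j i hji ↦ ?_, fun i ↦ hg i ▸ hc i _⟩
  exact hg i ▸ hne i (fun j _ ↦ g j) j hji

variable {M : Type u} [TopologicalSpace M]

theorem mk_isClosed_le_continuum [SecondCountableTopology M] :
    #{K : Set M // IsClosed K} ≤ 𝔠 := by
  obtain ⟨B, hBc, -, hB⟩ := TopologicalSpace.exists_countable_basis M
  refine (mk_subtype_le_of_subset fun K hK ↦ ?_).trans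
    (MeasurableSpace.cardinal_measurableSet_le_continuum (s := B)
      (hBc.le_aleph0.trans aleph0_le_continuum))
  borelize M
  rw [Set.mem_ofPred_eq, ← hB.borel_eq_generateFrom]
  exact IsClosed.measurableSet hK

theorem mk_le_continuum_of_secondCountable [SecondCountableTopology M] [T1Space M] : #M ≤ 𝔠 :=
  (mk_le_of_injective (f := fun x : M ↦ (⟨{x}, isClosed_singleton⟩ : {K : Set M // IsClosed K}))
    fun _ _ h ↦ Set.singleton_injective (congrArg Subtype.val h)).trans mk_isClosed_le_continuum

theorem continuum_le_mk_of_isClosed [PolishSpace M] {K : Set M} (hK : IsClosed K)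
    (hunc : ¬ K.Countable) : 𝔠 ≤ #K := by
  obtain ⟨f, hf, -, hinj⟩ := hK.exists_nat_bool_injection_of_not_countable hunc
  simpa using lift_mk_le_lift_mk_of_injective (hinj.codRestrict (Set.range_subset_iff.1 hf))

theorem exists_injOn_restrict_fin {α : Type*} (F : Finset (ℕ → α)) :
    ∃ N, Set.InjOn (fun (t : ℕ → α) (i : Fin N) ↦ t i) F := by
  classical
  let N := (F ×ˢ F).sup fun p ↦ PiNat.firstDiff p.1 p.2
  refine ⟨N + 1, fun s hs t ht hst ↦ by_contra fun hne ↦ PiNat.apply_firstDiff_ne hne ?_⟩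
  have hN : PiNat.firstDiff s t ≤ N :=
    Finset.le_sup (f := fun p ↦ PiNat.firstDiff p.1 p.2) (Finset.mk_mem_product hs ht)
  exact congrFun hst ⟨_, Nat.lt_succ_of_le hN⟩

end Cardinality

namespace GroupVariety

section LargeFamilies

variable {V : GroupVariety.{u}} {G : Type u} [Group G]

theorem rank_le_mk : V.rank G ≤ #G :=
  ciSup_le' fun X ↦ mk_set_le X.1

theorem nontrivial_of_aleph0_le_rank_pi (h : ℵ₀ ≤ V.rank (ℕ → G)) : Nontrivial G := by
  have : Infinite (ℕ → G) := infinite_iff.2 (h.trans rank_le_mk)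
  by_contra hG
  rw [not_nontrivial_iff_subsingleton] at hG
  exact not_finite (ℕ → G)

theorem exists_indepFamily_of_finite (h : ℵ₀ ≤ V.rank G) (E : Type) [Finite E] :
    ∃ e : E → G, V.IndepFamily e := by
  have hlt : lift.{u} #E < V.rank G := lt_of_lt_of_le (by simp) h
  obtain ⟨X, hX⟩ := (lt_ciSup_iff' bddAbove_of_small).1 hlt
  obtain ⟨f⟩ := lift_mk_le'.1 (hX.le.trans (lift_id'.{0, u} #X.1).ge)
  exact ⟨_, X.2.indepFamily.comp_injective f.injective⟩

theorem exists_indepFamily_nat_bool (h : ℵ₀ ≤ V.rank G) :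
    ∃ y : (ℕ → Bool) → ℕ → G, V.IndepFamily y := by
  choose e he using fun n : ℕ ↦ exists_indepFamily_of_finite h (Fin n → Bool)
  refine ⟨fun t n ↦ e n fun i ↦ t i, .of_finset fun F ↦ ?_⟩
  obtain ⟨N, hN⟩ := exists_injOn_restrict_fin F
  exact .of_hom_comp (Pi.evalMonoidHom (fun _ ↦ G) N) ((he N).comp_injective hN.injective)

variable [TopologicalSpace G] [PolishSpace G]

theorem IndepFamily.continuum_le_mk_generatorSupport {S : Type u} {y : S → G}
    (hy : V.IndepFamily y) (hG : V.Mem G) {K : Set G} (hK : IsClosed K) (hunc : ¬ K.Countable)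
    (hsub : K ⊆ Subgroup.closure (Set.range y)) : 𝔠 ≤ #(generatorSupport y K) := by
  by_contra! hlt
  refine (continuum_le_mk_of_isClosed hK hunc).not_gt ?_
  calc #K ≤ #(Subgroup.closure (y '' generatorSupport y K)) :=
        mk_le_mk_of_subset (hy.subset_closure_image_generatorSupport hG hsub)
    _ ≤ max #(y '' generatorSupport y K) ℵ₀ := mk_subgroup_closure_le _
    _ < 𝔠 := max_lt (mk_image_le.trans_lt hlt) aleph0_lt_continuum

theorem IndepFamily.exists_injective_countable_of_isClosed {S T : Type u} {y : S → G}
    (hy : V.IndepFamily y) (hG : V.Mem G) (hS : 𝔠 ≤ #S) (hT : #T ≤ 𝔠) :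
    ∃ j : T → S, Function.Injective j ∧ ∀ K : Set G, IsClosed K →
      K ⊆ Subgroup.closure (Set.range (y ∘ j)) → K.Countable := by
  let 𝒦 := {K : {K : Set G // IsClosed K} //
    ¬ K.1.Countable ∧ K.1 ⊆ Subgroup.closure (Set.range y)}
  have hcard : #(𝒦 ⊕ T) ≤ 𝔠 := by
    rw [mk_sum, lift_id, lift_id, ← continuum_add_self]
    exact add_le_add ((mk_subtype_le _).trans mk_isClosed_le_continuum) hT
  -- Each `K` in `𝒦` reserves an index needed to generate it, which `T` then avoids.
  let A : 𝒦 ⊕ T → Set S := Sum.elim (fun K ↦ generatorSupport y K.1) fun _ ↦ Set.univ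
  have hA : ∀ i, 𝔠 ≤ #(A i) := by
    rintro (K | t)
    · exact hy.continuum_le_mk_generatorSupport hG K.1.2 K.2.1 K.2.2
    · simpa [A] using hS
  obtain ⟨g, hg, hgA⟩ := exists_injective_forall_mem A fun i ↦ hcard.trans (hA i)
  refine ⟨g ∘ Sum.inr, hg.comp Sum.inr_injective, fun K hK hsub ↦ by_contra fun hunc ↦ ?_⟩
  let k : 𝒦 := ⟨⟨K, hK⟩, hunc,
    hsub.trans (Subgroup.closure_mono (Set.range_comp_subset_range _ _))⟩
  refine hgA (.inl k) (hsub.trans (Subgroup.closure_mono ?_))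
  rintro _ ⟨t, rfl⟩
  exact ⟨g (.inr t), hg.ne Sum.inr_ne_inl, rfl⟩

theorem exists_indepFamily_countable_of_isClosed (hG : V.Mem G) (h : ℵ₀ ≤ V.rank G) {T : Type u}
    (hT : #T ≤ 𝔠) :
    ∃ y : T → ℕ → G, V.IndepFamily y ∧ ∀ K : Set (ℕ → G), IsClosed K →
      K ⊆ Subgroup.closure (Set.range y) → K.Countable := by
  obtain ⟨y, hy⟩ := exists_indepFamily_nat_bool h
  have hy' := hy.comp_injective (ULift.down_injective.{0, u})
  obtain ⟨j, hj, hcl⟩ := hy'.exists_injective_countable_of_isClosed (mem_pi hG) (by simp) hT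
  exact ⟨_, hy'.comp_injective hj, hcl⟩

end LargeFamilies

end GroupVariety

/-! ### Dense subsets of powers -/

section Topology

open Topology

theorem GDeltaDense.dense {X : Type u} [TopologicalSpace X] {D : Set X} (hD : GDeltaDense D) :
    Dense D :=
  dense_iff_inter_open.2 fun U hU hne ↦ Set.inter_comm D U ▸ hD U hU.isGδ hne

theorem topWeight_le_aleph0_iff {X : Type u} [TopologicalSpace X] :
    topWeight X ≤ ℵ₀ ↔ SecondCountableTopology X := by
  refine ⟨fun h ↦ ?_, fun _ ↦ ?_⟩
  · obtain ⟨B, hB, hBX⟩ := csInf_mem (s := {κ | ∃ B : Set (Set X),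
      TopologicalSpace.IsTopologicalBasis B ∧ #B = κ})
      ⟨_, {U | IsOpen U}, TopologicalSpace.isTopologicalBasis_opens, rfl⟩
    exact hB.secondCountableTopology (mk_le_aleph0_iff.1 (hBX.trans_le h))
  · obtain ⟨B, hBc, -, hB⟩ := TopologicalSpace.exists_countable_basis X
    exact (csInf_le' ⟨B, hB, rfl⟩ : topWeight X ≤ #B).trans hBc.le_aleph0

theorem secondCountableTopology_of_compact_countable {X : Type*} [TopologicalSpace X]
    [CompactSpace X] [T2Space X] [Countable X] : SecondCountableTopology X := by
  have hsep (p : {p : X × X // p.1 ≠ p.2}) : ∃ f : X → ℝ, Continuous f ∧ f p.1.1 ≠ f p.1.2 :=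
    separatesPoints_continuous_of_t35Space p.2
  choose f hf hne using hsep
  refine ((continuous_pi hf).isClosedEmbedding fun x x' h ↦ ?_).isEmbedding.secondCountableTopology
  by_contra hxx'
  exact hne ⟨(x, x'), hxx'⟩ (congrFun h _)

theorem not_isWCompact_of_forall_isCompact_countable {X : Type u} [TopologicalSpace X] [T2Space X]
    (hC : ∀ C : Set X, IsCompact C → C.Countable) (hX : ¬ SecondCountableTopology X) :
    ¬ IsWCompact X := by
  rintro ⟨C, hcomp, hw⟩
  have := isCompact_iff_compactSpace.1 hcomp
  have := (hC C hcomp).to_subtype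
  exact hX (topWeight_le_aleph0_iff.1
    (hw ▸ topWeight_le_aleph0_iff.2 secondCountableTopology_of_compact_countable))

theorem exists_countable_forall_eqOn_mem {I L X : Type*} [TopologicalSpace L]
    [TopologicalSpace X] {g : X → I → L} (hg : IsInducing g) {B : Set X} (hB : IsGδ B) {a : X}
    (ha : a ∈ B) : ∃ J : Set I, J.Countable ∧ ∀ x, Set.EqOn (g x) (g a) J → x ∈ B := by
  obtain ⟨U, hU, rfl⟩ := hB.eq_iInter_nat
  have hF (n : ℕ) : ∃ F : Finset I, ∀ x, Set.EqOn (g x) (g a) F → x ∈ U n := by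
    obtain ⟨W, hW, hWU⟩ := hg.isOpen_iff.1 (hU n)
    obtain ⟨F, u, hu, hsub⟩ := isOpen_pi_iff.1 hW (g a) (by
      rw [← Set.mem_preimage, hWU]
      exact Set.mem_iInter.1 ha n)
    refine ⟨F, fun x hx ↦ hWU ▸ hsub fun i hi ↦ ?_⟩
    rw [hx hi]
    exact (hu i hi).2
  choose F hF using hF
  refine ⟨⋃ n, F n, Set.countable_iUnion fun n ↦ (F n).countable_toSet, fun x hx ↦ ?_⟩
  exact Set.mem_iInter.2 fun n ↦ hF n x (hx.mono (Set.subset_iUnion (fun n ↦ (F n : Set I)) n))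

open Classical in
theorem mapClusterPt_piecewise {I L ι : Type*} [TopologicalSpace L] {l : Filter ι}
    {u : ι → I → L} {p a : I → L} {K : Set I} (hp : MapClusterPt p l u) (hap : Set.EqOn a p K) :
    MapClusterPt a l fun n ↦ K.piecewise (u n) a := by
  have hcont : Continuous fun z : I → L ↦ K.piecewise z a := continuous_pi fun i ↦ by
    by_cases hi : i ∈ K <;> simp only [Set.piecewise, hi, if_true, if_false] <;> fun_prop
  have hpa : K.piecewise p a = a := by
    ext i
    by_cases hi : i ∈ K
    · rw [Set.piecewise_eq_of_mem _ _ _ hi, hap hi]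
    · rw [Set.piecewise_eq_of_notMem _ _ _ hi]
  simpa only [hpa] using! hp.continuousAt_comp hcont.continuousAt

/-- The set `D` projects onto every countable subproduct of `L ^ I`. This makes `D`
`G_δ`-dense, and is the form in which `G_δ`-density is used and verified. -/
def ProjectsOntoCountable {I L : Type*} (D : Set (I → L)) : Prop :=
  ∀ (p : I → L) (J : Set I), J.Countable → ∃ d ∈ D, Set.EqOn d p J

namespace ProjectsOntoCountable

theorem mono {I L : Type*} {D E : Set (I → L)} (hD : ProjectsOntoCountable D) (h : D ⊆ E) :
    ProjectsOntoCountable E := fun p J hJ ↦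
  let ⟨d, hd, hdp⟩ := hD p J hJ
  ⟨d, h hd, hdp⟩

theorem gDeltaDense {I L : Type u} [TopologicalSpace L] {D : Set (I → L)}
    (hD : ProjectsOntoCountable D) : GDeltaDense D := by
  rintro B hB ⟨p, hp⟩
  obtain ⟨J, hJ, hJB⟩ := exists_countable_forall_eqOn_mem .id hB hp
  obtain ⟨d, hd, hdp⟩ := hD p J hJ
  exact ⟨d, hd, hJB d hdp⟩

theorem isPseudocompact {I L : Type u} [TopologicalSpace L] [CompactSpace L] {D : Set (I → L)}
    (hD : ProjectsOntoCountable D) : IsPseudocompact D := by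
  classical
  intro f hf
  by_contra! hunb
  choose d hd using fun n : ℕ ↦ hunb n
  choose J hJ hdJ using fun n ↦ exists_countable_forall_eqOn_mem .subtypeVal
    (isOpen_lt continuous_const hf.abs).isGδ (hd n)
  let K : Set I := ⋃ n, J n
  have hK : K.Countable := Set.countable_iUnion hJ
  obtain ⟨p, hp⟩ := exists_clusterPt_of_compactSpace (Filter.atTop.map fun n ↦ (d n : I → L))
  obtain ⟨a, ha, hap⟩ := hD p K hK
  -- Replacing `d n` by `a` outside `K` keeps `|f|` large and gives points accumulating at `a ∈ D`.
  have hclus := mapClusterPt_piecewise hp hap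
  obtain ⟨W, hW, hWf⟩ := isOpen_induced_iff.1 (isOpen_lt hf.abs continuous_const :
    IsOpen {x : D | |f x| < |f ⟨a, ha⟩| + 1})
  have haW : a ∈ W := (Set.ext_iff.1 hWf ⟨a, ha⟩).2 (lt_add_one |f ⟨a, ha⟩|)
  obtain ⟨m, hm⟩ := exists_nat_ge (|f ⟨a, ha⟩| + 1)
  obtain ⟨n, hmn, hn⟩ := Filter.frequently_atTop.1
    (mapClusterPt_iff_frequently.1 hclus W (hW.mem_nhds haW)) m
  obtain ⟨E, hE, hEW⟩ := exists_countable_forall_eqOn_mem .id hW.isGδ hn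
  obtain ⟨x, hx, hxr⟩ := hD _ (K ∪ E) (hK.union hE)
  have h_gt : (n : ℝ) < |f ⟨x, hx⟩| := hdJ n ⟨x, hx⟩ fun i hi ↦ by
    have hiK : i ∈ K := Set.mem_iUnion_of_mem n hi
    exact (hxr (.inl hiK)).trans (Set.piecewise_eq_of_mem K (d n : I → L) a hiK)
  have h_lt : |f ⟨x, hx⟩| < |f ⟨a, ha⟩| + 1 :=
    (Set.ext_iff.1 hWf ⟨x, hx⟩).1 (hEW x fun i hi ↦ hxr (.inr hi))
  exact absurd (h_gt.trans (h_lt.trans_le hm)) (not_lt.2 (Nat.cast_le.2 hmn))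

theorem not_firstCountableTopology {I L : Type*} [TopologicalSpace L] [T1Space L] [Nontrivial L]
    [Uncountable I] {D : Set (I → L)} (hD : ProjectsOntoCountable D) :
    ¬ FirstCountableTopology D := by
  classical
  intro _
  obtain ⟨a, ha, -⟩ := hD (fun _ ↦ Classical.arbitrary L) ∅ Set.countable_empty
  obtain ⟨J, hJ, hJa⟩ := exists_countable_forall_eqOn_mem .subtypeVal
    (IsGδ.singleton (⟨a, ha⟩ : D)) rfl
  obtain ⟨i, hi⟩ := Set.nonempty_compl.2 fun h : J = .univ ↦ Set.not_countable_univ (h ▸ hJ)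
  obtain ⟨l, hl⟩ := exists_ne (a i)
  obtain ⟨x, hx, hxl⟩ := hD (Function.update a i l) (insert i J) (hJ.insert i)
  have hxa : (⟨x, hx⟩ : D) = ⟨a, ha⟩ := hJa _ fun k hk ↦
    (hxl (.inr hk)).trans (Function.update_of_ne (ne_of_mem_of_not_mem hk hi) _ _)
  have hxi : x i = a i := congrFun (congrArg Subtype.val hxa) i
  exact hl (by rw [← hxi, hxl (.inl rfl), Function.update_self])

end ProjectsOntoCountable

end Topology

/-! ### The construction -/

section EventualCoordinates

open Filter Topology

variable {B T : Type*} {l : Filter B}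

instance cocountable_neBot [Uncountable B] : (cocountable : Filter B).NeBot :=
  ⟨fun h ↦ Set.not_countable_univ (by
    simpa only [Set.compl_empty] using mem_cocountable.1 (empty_mem_iff_bot.2 h))⟩

instance cocountable_countableInterFilter : CountableInterFilter (cocountable : Filter B) :=
  cardinalInterFilter_aleph_one_iff.1 inferInstance

theorem isClosed_image_of_eventually_eq {P M : Type*} [TopologicalSpace P] [TopologicalSpace M]
    [T2Space M] [SequentialSpace M] [l.NeBot] [CountableInterFilter l] {ρ : B → P → M}
    (hρ : ∀ b, Continuous (ρ b)) {θ : P → M} {C : Set P} (hC : IsCompact C)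
    (hθ : ∀ d ∈ C, ∀ᶠ b in l, ρ b d = θ d) : IsClosed (θ '' C) := by
  refine IsSeqClosed.isClosed fun c z hc hz ↦ ?_
  choose d hdC hdc using hc
  obtain ⟨p, hpC, hp⟩ := hC.exists_mapClusterPt (f := atTop) (tendsto_principal.2 (.of_forall hdC))
  obtain ⟨b, hbd, hbp⟩ :=
    ((eventually_countable_forall.2 fun n ↦ hθ (d n) (hdC n)).and (hθ p hpC)).exists
  have hclus : MapClusterPt (θ p) atTop c := by
    have hbc : ρ b ∘ d = c := funext fun n ↦ (hbd n).trans (hdc n)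
    exact hbp ▸ hbc ▸ hp.continuousAt_comp (hρ b).continuousAt
  exact ⟨p, hpC, eq_of_nhds_neBot (hclus.neBot.mono (inf_le_inf_left _ hz))⟩

variable {P M : Type*} [Group P] [Group M] {ρ : B → P →* M} {x : T → P} {y : T → M}

theorem eventually_map_freeGroup_lift_eq (hx : ∀ t, ∀ᶠ b in l, ρ b (x t) = y t) (w : FreeGroup T) :
    ∀ᶠ b in l, ρ b (FreeGroup.lift x w) = FreeGroup.lift y w := by
  induction w using FreeGroup.induction_on with
  | C1 => simp
  | of t => simpa using hx t
  | inv_of t ht => filter_upwards [ht] with b hb using by rw [map_inv, map_inv, map_inv, hb]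
  | mul v w hv hw =>
    filter_upwards [hv, hw] with b hbv hbw using by rw [map_mul, map_mul, map_mul, hbv, hbw]

namespace GroupVariety

variable {V : GroupVariety.{u}}

theorem IndepFamily.of_eventually [l.NeBot] (hy : V.IndepFamily y)
    (hx : ∀ t, ∀ᶠ b in l, ρ b (x t) = y t) : V.IndepFamily x := fun w hw ↦
  let ⟨b, hb⟩ := (eventually_map_freeGroup_lift_eq hx w).exists
  hy w (by rw [← hb, hw, map_one])

theorem IndepFamily.countable_of_isCompact {P : Type u} [Group P] [TopologicalSpace P]
    [TopologicalSpace M] [T2Space M] [SequentialSpace M] [l.NeBot] [CountableInterFilter l]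
    {ρ : B → P →* M} {x : T → P} (hy : V.IndepFamily y) (hP : V.Mem P)
    (hρ : ∀ b, Continuous (ρ b)) (hx : ∀ t, ∀ᶠ b in l, ρ b (x t) = y t)
    (hcl : ∀ K : Set M, IsClosed K → K ⊆ Subgroup.closure (Set.range y) → K.Countable)
    {C : Set P} (hC : IsCompact C) (hsub : C ⊆ Subgroup.closure (Set.range x)) :
    C.Countable := by
  choose! w hw using fun d (hd : d ∈ C) ↦ mem_subgroup_closure_range_iff.1 (hsub hd)
  let θ : P → M := fun d ↦ FreeGroup.lift y (w d)
  have hθ : ∀ d ∈ C, ∀ᶠ b in l, ρ b d = θ d := fun d hd ↦ by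
    simpa only [hw d hd] using eventually_map_freeGroup_lift_eq hx (w d)
  have hinj : Set.InjOn θ C := fun d hd d' hd' h ↦ by
    simpa only [hw d hd, hw d' hd'] using hy.lift_eq_lift h hP x
  refine Set.countable_of_injective_of_countable_image hinj
    (hcl _ (isClosed_image_of_eventually_eq hρ hC hθ) ?_)
  rintro _ ⟨d, -, rfl⟩
  exact mem_subgroup_closure_range_iff.2 ⟨w d, rfl⟩

end GroupVariety

end EventualCoordinates

section Patch

open Filter

variable {B M : Type*}

/-- The point of `M ^ B` all of whose coordinates are `y t`, except for countably many prescribed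
by `t`: the coordinate at `(t k).1` is `(t k).2`, provided that the sequence `t` makes no
conflicting prescriptions. The values of `patch y` satisfy all countable prescriptions, and
almost all of their coordinates form the family `y`. -/
noncomputable def patch (y : (ℕ → B × M) → M) (t : ℕ → B × M) : B → M :=
  Function.extend (fun k ↦ (t k).1) (fun k ↦ (t k).2) fun _ ↦ y t

theorem eventually_patch_eq (y : (ℕ → B × M) → M) (t : ℕ → B × M) :
    ∀ᶠ b in cocountable, patch y t b = y t := by
  have h : (Set.range fun k ↦ (t k).1)ᶜ ∈ cocountable :=
    mem_cocountable.2 (by rw [compl_compl]; exact Set.countable_range _)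
  filter_upwards [h] with b hb using Function.extend_apply' _ _ _ hb

theorem projectsOntoCountable_range_patch [Nonempty B] (y : (ℕ → B × M) → M) :
    ProjectsOntoCountable (Set.range (patch y)) := by
  intro p J hJ
  obtain ⟨s, hs⟩ := Set.countable_iff_exists_subset_range.1 hJ
  refine ⟨_, ⟨fun k ↦ (s k, p (s k)), rfl⟩, fun b hb ↦ ?_⟩
  obtain ⟨k, rfl⟩ := hs hb
  exact Function.FactorsThrough.extend_apply (fun _ _ h ↦ congrArg p h) _ k

end Patch

section Blocks

variable {I B J K L : Type*} [Group L]

/-- The partition of the coordinates of `L ^ I` into blocks indexed by `B`, each of which is a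
copy of `(L ^ K) ^ J`. -/
def blocks (e : I ≃ B × J × K) : (I → L) ≃* (B → J → K → L) where
  toFun p b j k := p (e.symm (b, j, k))
  invFun q i := q (e i).1 (e i).2.1 (e i).2.2
  left_inv p := by simp
  right_inv q := by simp
  map_mul' _ _ := rfl

theorem continuous_blocks [TopologicalSpace L] (e : I ≃ B × J × K) :
    Continuous (blocks (L := L) e) :=
  continuous_pi fun _ ↦ continuous_pi fun _ ↦ continuous_pi fun _ ↦ continuous_apply _

theorem ProjectsOntoCountable.image_blocks_symm (e : I ≃ B × J × K) {E : Set (B → J → K → L)}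
    (hE : ProjectsOntoCountable E) : ProjectsOntoCountable ((blocks e).symm '' E) := by
  intro p A hA
  obtain ⟨q, hq, hqp⟩ := hE (blocks e p) ((fun i ↦ (e i).1) '' A) (hA.image _)
  refine ⟨_, ⟨q, hq, rfl⟩, fun i hi ↦ ?_⟩
  change q (e i).1 (e i).2.1 (e i).2.2 = p i
  rw [hqp ⟨i, hi, rfl⟩]
  exact congrArg p (e.symm_apply_apply i)

end Blocks

namespace GroupVariety

variable {V : GroupVariety.{u}} {L : Type u} [Group L] [TopologicalSpace L] [PolishSpace L]

theorem exists_indepFamily_projectsOntoCountable (hL : V.Mem L) (hrank : ℵ₀ ≤ V.rank (ℕ → L))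
    {I : Type u} [Uncountable I] (hI : #I ≤ 𝔠) :
    ∃ (T : Type u) (x : T → I → L),
      #T = 𝔠 ∧ V.IndepFamily x ∧ ProjectsOntoCountable (Set.range x) ∧
      ∀ C : Set (I → L), IsCompact C → C ⊆ Subgroup.closure (Set.range x) → C.Countable := by
  let M := ℕ → ℕ → L
  have hIM : #(I × M) ≤ 𝔠 := by
    rw [mk_prod, lift_id, lift_id, ← continuum_mul_self]
    exact mul_le_mul' hI mk_le_continuum_of_secondCountable
  have hT : #(ℕ → I × M) = 𝔠 := by
    have two_le : (2 : Cardinal) ≤ #(I × M) := natCast_le_aleph0.trans (aleph0_le_mk _)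
    simpa using power_aleph0_of_le_continuum two_le hIM
  obtain ⟨e⟩ : Nonempty (I ≃ I × ℕ × ℕ) := Cardinal.eq.1 (by simp [mul_aleph0_eq (aleph0_le_mk I)])
  obtain ⟨y, hy, hcl⟩ := exists_indepFamily_countable_of_isClosed (mem_pi hL) hrank hT.le
  let x : (ℕ → I × M) → I → L := (blocks e).symm ∘ patch y
  let ρ : I → (I → L) →* M := fun β ↦ (Pi.evalMonoidHom (fun _ ↦ M) β).comp (blocks e).toMonoidHom
  have hρ (β : I) : Continuous (ρ β) := (continuous_apply β).comp (continuous_blocks e)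
  have hx (t : ℕ → I × M) : ∀ᶠ β in Filter.cocountable, ρ β (x t) = y t := by
    filter_upwards [eventually_patch_eq y t] with β hβ using by simpa [ρ, x] using hβ
  refine ⟨_, x, hT, hy.of_eventually hx, ?_, fun C ↦ hy.countable_of_isCompact
    (V.pi_mem I _ fun _ ↦ hL) hρ hx hcl⟩
  rw [Set.range_comp]
  exact (projectsOntoCountable_range_patch y).image_blocks_symm e

end GroupVariety

theorem theorem5p2_general (V : GroupVariety.{u}) (L : Type u) [Group L] [TopologicalSpace L]
    [PolishSpace L] (hL : V.Mem L) (hrank : ℵ₀ ≤ V.rank (ℕ → L))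
    (I : Type u) (hI : ℵ₁ ≤ #I) (hI' : #I ≤ 𝔠) :
    ∃ D : Subgroup (I → L),
      GDeltaDense (D : Set (I → L)) ∧
      Dense (D : Set (I → L)) ∧
      (CompactSpace L → IsPseudocompact D) ∧
      V.IsFree D ∧
      #D = 𝔠 ∧
      (∀ C : Set D, IsCompact C → C.Countable) ∧
      ¬ IsWCompact D := by
  have : Uncountable I := aleph0_lt_mk_iff.1 (aleph0_lt_aleph_one.trans_le hI)
  have : Nontrivial L := GroupVariety.nontrivial_of_aleph0_le_rank_pi hrank
  obtain ⟨T, x, hT, hx, hproj, hcpt⟩ :=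
    GroupVariety.exists_indepFamily_projectsOntoCountable hL hrank hI'
  have hLI : V.Mem (I → L) := V.pi_mem I _ fun _ ↦ hL
  let D := Subgroup.closure (Set.range x)
  have hD : ProjectsOntoCountable (D : Set (I → L)) := hproj.mono Subgroup.subset_closure
  have hrange : #(Set.range x) = 𝔠 := (mk_range_eq x (hx.injective hLI)).trans hT
  have hmk : #D = 𝔠 := le_antisymm
    ((mk_subgroup_closure_le _).trans (max_le hrange.le aleph0_le_continuum))
    (hrange.ge.trans (mk_le_mk_of_subset Subgroup.subset_closure))
  have hcountable (C : Set D) (hC : IsCompact C) : C.Countable :=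
    Set.countable_of_injective_of_countable_image Subtype.val_injective.injOn
      (hcpt _ (hC.image continuous_subtype_val) (Subtype.coe_image_subset _ C))
  exact ⟨D, hD.gDeltaDense, hD.gDeltaDense.dense, fun _ ↦ hD.isPseudocompact,
    hx.isFree_closure_range hLI, hmk, hcountable,
    not_isWCompact_of_forall_isCompact_countable hcountable fun _ ↦
      hD.not_firstCountableTopology inferInstance⟩

theorem theorem5p2 (V : GroupVariety.{u}) (L : Type u) [Group L] [TopologicalSpace L]
    [IsTopologicalGroup L] [CompactSpace L] [TopologicalSpace.MetrizableSpace L]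
    (hL : V.Mem L) (hrank : ℵ₀ ≤ V.rank (ℕ → L))
    (I : Type u) (hI : ℵ₁ ≤ #I) (hI' : #I ≤ 𝔠) :
    ∃ D : Subgroup (I → L),
      GDeltaDense (D : Set (I → L)) ∧
      Dense (D : Set (I → L)) ∧
      IsPseudocompact D ∧
      V.IsFree D ∧
      #D = 𝔠 ∧
      (∀ C : Set D, IsCompact C → C.Countable) ∧
      ¬ IsWCompact D := by
  have : PolishSpace L := by
    let := TopologicalSpace.metrizableSpaceMetric L
    infer_instance
  simpa only [forall_prop_of_true ‹CompactSpace L›] using theorem5p2_general V L hL hrank I hI hI'
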